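/- Let $(E,\mathcal E)$ be a measurable space with countably generated $\sigma$-field and let $V:E\to(0,+\infty)$ be measurable. Let $L^\infty(V)$ be the Banach space of all measurable $f:E\to\mathbb C$ such that $|f|\le CV$ for some constant $C>0$, with norm $\|f\|_V=\sup_{x\in E}|f(x)|/V(x)$. For a bounded linear operator $T$ on $L^\infty(V)$, with operator norm $\|T\|$, let $r(T)$ be its spectral radius and let $$r_{ess}(T)=\lim_{n\to\infty}\inf\big\{\|T^n-K\|^{1/n}: K \text{ a compact operator on } L^\infty(V)\big\}$$ be its essential spectral radius; $T$ is called quasi-compact if $r_{ess}(T)<r(T)$, and positive if $Tf\ge 0$ for all $f\in L^\infty(V)$ with $f\ge 0$. Let $P$ be a (nonnegative) kernel on $E$ such that $PV\le CV$ for some finite constant $C$, where $Pf(x)=\int_E f(y)\,P(x,dy)$; it defines a bounded operator $P$ on $L^\infty(V)$. Suppose that there is a measurable set $E_K\subset E$ such that: (H1) there exists $\theta_1\in(0,r(P))$ such that $PV(x)\le\theta_1V(x)$ for all $x\in E\setminus E_K$; (H2) there exist $\theta_2\in(0,r(P))$ and a positive compact operator $K$ on $L^\infty(V)$ such that $$0\le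 Pf(x)\le Kf(x)+\theta_2V(x)\|f\|_V\qquad\text{for all }x\in E_K\text{ and all }f\in L^\infty(V)\text{ with }f\ge 0.$$ Then $P$ is quasi-compact on $L^\infty(V)$, and $r_{ess}(P)\le\max(\theta_1,\theta_2)$. -/

import Mathlib

open Filter Topology MeasureTheory ProbabilityTheory
open scoped NNReal ENNReal ComplexOrder

noncomputable section

/-! ### Essential spectral radius and quasi-compactness -/

section EssentialSpectralRadius

variable {X : Type*} [NormedAddCommGroup X] [NormedSpace ℂ X]

/-- The essential spectral radius
`r_ess(T) = lim_n inf { ‖T ^ n - K‖ ^ (1 / n) : K compact }` of a bounded operator `T`.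
The limit always exists, see `tendsto_essSpectralRadius`. -/
def essSpectralRadius (T : X →L[ℂ] X) : ℝ :=
  limUnder atTop fun n : ℕ =>
    ⨅ K : {K : X →L[ℂ] X // IsCompactOperator K}, ‖T ^ n - K.1‖ ^ (1 / (n : ℝ))

/-- `T` is quasi-compact if `r_ess(T) < r(T)`. -/
def IsQuasiCompact (T : X →L[ℂ] X) : Prop :=
  ENNReal.ofReal (essSpectralRadius T) < spectralRadius ℂ T

/-- The distance from `T ^ n` to the compact operators. -/
def distCompact (T : X →L[ℂ] X) (n : ℕ) : ℝ :=
  ⨅ K : {K : X →L[ℂ] X // IsCompactOperator K}, ‖T ^ n - K.1‖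

instance : Nonempty {K : X →L[ℂ] X // IsCompactOperator K} :=
  ⟨⟨0, isCompactOperator_zero⟩⟩

theorem bddBelow_distCompact (T : X →L[ℂ] X) (n : ℕ) :
    BddBelow (Set.range fun K : {K : X →L[ℂ] X // IsCompactOperator K} => ‖T ^ n - K.1‖) :=
  ⟨0, by rintro _ ⟨K, rfl⟩; exact norm_nonneg _⟩

theorem distCompact_nonneg (T : X →L[ℂ] X) (n : ℕ) : 0 ≤ distCompact T n :=
  Real.iInf_nonneg fun _ => norm_nonneg _

theorem distCompact_add_le (T : X →L[ℂ] X) (m n : ℕ) :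
    distCompact T (m + n) ≤ distCompact T m * distCompact T n := by
  have key : ∀ K L : {K : X →L[ℂ] X // IsCompactOperator K},
      distCompact T (m + n) ≤ ‖T ^ m - K.1‖ * ‖T ^ n - L.1‖ := by
    intro K L
    have hc : IsCompactOperator (T ^ m * L.1 + K.1 * T ^ n - K.1 * L.1 : X →L[ℂ] X) := by
      have h1 : IsCompactOperator (T ^ m * L.1 : X →L[ℂ] X) := L.2.clm_comp (T ^ m)
      have h2 : IsCompactOperator (K.1 * T ^ n : X →L[ℂ] X) := K.2.comp_clm (T ^ n)
      have h3 : IsCompactOperator (K.1 * L.1 : X →L[ℂ] X) := K.2.comp_clm L.1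
      exact (h1.add h2).sub h3
    refine (ciInf_le (bddBelow_distCompact T (m + n)) ⟨_, hc⟩).trans ?_
    have : T ^ (m + n) - (T ^ m * L.1 + K.1 * T ^ n - K.1 * L.1)
        = (T ^ m - K.1) * (T ^ n - L.1) := by
      rw [pow_add]; noncomm_ring
    simp only [this]
    exact norm_mul_le _ _
  have h1 : ∀ K : {K : X →L[ℂ] X // IsCompactOperator K},
      distCompact T (m + n) ≤ ‖T ^ m - K.1‖ * distCompact T n := by
    intro K
    rw [distCompact, distCompact, Real.mul_iInf_of_nonneg (norm_nonneg _)]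
    exact le_ciInf fun L => key K L
  rw [distCompact.eq_1 T m, Real.iInf_mul_of_nonneg (distCompact_nonneg T n)]
  exact le_ciInf h1

theorem iInf_rpow_eq (T : X →L[ℂ] X) (n : ℕ) :
    (⨅ K : {K : X →L[ℂ] X // IsCompactOperator K}, ‖T ^ n - K.1‖ ^ (1 / (n : ℝ)))
      = distCompact T n ^ (1 / (n : ℝ)) := by
  apply le_antisymm
  · rcases Nat.eq_zero_or_pos n with rfl | hn
    · simp
    have hp : (0 : ℝ) < 1 / n := by positivity
    have hb : BddBelow (Set.range fun K : {K : X →L[ℂ] X // IsCompactOperator K} =>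
        ‖T ^ n - K.1‖ ^ (1 / (n : ℝ))) := ⟨0, by rintro _ ⟨K, rfl⟩; positivity⟩
    have h0 : 0 ≤ ⨅ K : {K : X →L[ℂ] X // IsCompactOperator K},
        ‖T ^ n - K.1‖ ^ (1 / (n : ℝ)) := Real.iInf_nonneg fun _ => by positivity
    rw [show distCompact T n ^ (1 / (n : ℝ)) = distCompact T n ^ (n : ℝ)⁻¹ by rw [one_div],
      Real.le_rpow_inv_iff_of_pos h0 (distCompact_nonneg T n) (by positivity), distCompact]
    refine le_ciInf fun K => ?_
    rw [← Real.le_rpow_inv_iff_of_pos h0 (norm_nonneg _) (by positivity)]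
    simpa only [one_div] using ciInf_le hb K
  · exact le_ciInf fun K => Real.rpow_le_rpow (distCompact_nonneg T n)
      (ciInf_le (bddBelow_distCompact T n) K) (by positivity)

/-- A bounded-below-by-zero submultiplicative sequence has a limit of `n`-th roots. -/
theorem exists_tendsto_rpow_of_submul {a : ℕ → ℝ} (h0 : ∀ n, 0 ≤ a n)
    (ha : ∀ m n, a (m + n) ≤ a m * a n) :
    ∃ l, Tendsto (fun n : ℕ => a n ^ (1 / (n : ℝ))) atTop (𝓝 l) := by
  have hc : ∀ c : ℝ, 0 < c →
      ∃ l, Tendsto (fun n : ℕ => max (a n ^ (1 / (n : ℝ))) c) atTop (𝓝 l) := by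
    intro c hc
    have hpos : ∀ n, 0 < max (a n) (c ^ n) := fun n => lt_max_of_lt_right (pow_pos hc n)
    have hsub : Subadditive fun n => Real.log (max (a n) (c ^ n)) := by
      intro m n
      rw [← Real.log_mul (hpos m).ne' (hpos n).ne']
      refine Real.log_le_log (hpos _) (max_le ?_ ?_)
      · exact (ha m n).trans (mul_le_mul (le_max_left _ _) (le_max_left _ _) (h0 n) (hpos m).le)
      · rw [pow_add]
        exact mul_le_mul (le_max_right _ _) (le_max_right _ _) (pow_pos hc n).le (hpos m).le
    have hbdd : BddBelow (Set.range fun n : ℕ => Real.log (max (a n) (c ^ n)) / n) := by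
      refine ⟨min 0 (Real.log c), ?_⟩
      rintro _ ⟨n, rfl⟩
      rcases Nat.eq_zero_or_pos n with rfl | hn
      · simp
      · refine (min_le_right _ _).trans ?_
        rw [le_div_iff₀ (by positivity), mul_comm, ← Real.log_pow]
        exact Real.log_le_log (pow_pos hc n) (le_max_right _ _)
    refine ⟨Real.exp hsub.lim, ?_⟩
    refine ((Real.continuous_exp.tendsto _).comp (hsub.tendsto_lim hbdd)).congr' ?_
    filter_upwards [eventually_ge_atTop 1] with n hn
    have hn' : (n : ℝ) ≠ 0 := by positivity
    have hm : max (a n ^ (1 / (n : ℝ))) c = (max (a n) (c ^ n)) ^ (1 / (n : ℝ)) := by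
      have : c = (c ^ n) ^ (1 / (n : ℝ)) := by
        rw [← Real.rpow_natCast, ← Real.rpow_mul hc.le, mul_one_div_cancel hn', Real.rpow_one]
      have hmono : MonotoneOn (fun x : ℝ => x ^ (1 / (n : ℝ))) (Set.Ici 0) :=
        Real.monotoneOn_rpow_Ici_of_exponent_nonneg (by positivity)
      rw [hmono.map_max (h0 n) (pow_pos hc n).le, ← this]
    rw [hm, Real.rpow_def_of_pos (hpos n)]
    simp [div_eq_mul_inv]
  by_cases h : ∃ c l, 0 < c ∧ c < l ∧
      Tendsto (fun n : ℕ => max (a n ^ (1 / (n : ℝ))) c) atTop (𝓝 l)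
  · obtain ⟨c, l, -, hcl, hl⟩ := h
    refine ⟨l, hl.congr' ?_⟩
    filter_upwards [hl.eventually (lt_mem_nhds hcl)] with n hn
    rcases lt_max_iff.1 hn with h | h
    · exact max_eq_left h.le
    · exact absurd h (lt_irrefl _)
  · push Not at h
    refine ⟨0, tendsto_order.2 ⟨fun b hb => Eventually.of_forall fun n =>
      hb.trans_le (Real.rpow_nonneg (h0 n) _), fun b hb => ?_⟩⟩
    obtain ⟨l, hl⟩ := hc (b / 2) (by positivity)
    have hlb : l ≤ b / 2 := not_lt.1 fun hlt => h (b / 2) l (by positivity) hlt hl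
    filter_upwards [hl.eventually (gt_mem_nhds (show l < b by linarith))] with n hn
    exact (le_max_left _ _).trans_lt hn

/-- The limit defining the essential spectral radius exists. -/
theorem tendsto_essSpectralRadius (T : X →L[ℂ] X) :
    Tendsto (fun n : ℕ =>
      ⨅ K : {K : X →L[ℂ] X // IsCompactOperator K}, ‖T ^ n - K.1‖ ^ (1 / (n : ℝ)))
      atTop (𝓝 (essSpectralRadius T)) := by
  apply tendsto_nhds_limUnder
  simp only [iInf_rpow_eq]
  exact exists_tendsto_rpow_of_submul (distCompact_nonneg T) (distCompact_add_le T)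

end EssentialSpectralRadius

/-! ### The weighted space `L^∞(V)` -/

section WeightedSpace

variable {E : Type*} [MeasurableSpace E]

/-- The measurable functions `f : E → ℂ` with `|f| ≤ C V` for some constant `C > 0`. -/
def weightedSubmodule (V : E → ℝ≥0) : Submodule ℂ (E → ℂ) where
  carrier := {f | Measurable f ∧ ∃ C : ℝ, 0 < C ∧ ∀ x, ‖f x‖ ≤ C * V x}
  zero_mem' := ⟨measurable_const, 1, one_pos, fun x => by simp⟩
  add_mem' := by
    rintro f g ⟨hf, C, hC, hfC⟩ ⟨hg, D, hD, hgD⟩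
    refine ⟨hf.add hg, C + D, add_pos hC hD, fun x => ?_⟩
    rw [add_mul]
    exact (norm_add_le _ _).trans (add_le_add (hfC x) (hgD x))
  smul_mem' := by
    rintro c f ⟨hf, C, hC, hfC⟩
    refine ⟨hf.const_smul c, (‖c‖ + 1) * C, by positivity, fun x => ?_⟩
    rw [Pi.smul_apply, norm_smul, mul_assoc]
    exact mul_le_mul (by linarith) (hfC x) (norm_nonneg _) (by positivity)

/-- The space `L^∞(V)` (a type of its own, so that it carries the weighted norm only and not the
topology of pointwise convergence). -/
def WeightedLinf (V : E → ℝ≥0) : Type _ := weightedSubmodule V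

namespace WeightedLinf

variable {V : E → ℝ≥0}

instance : AddCommGroup (WeightedLinf V) := inferInstanceAs (AddCommGroup (weightedSubmodule V))

instance : Module ℂ (WeightedLinf V) := inferInstanceAs (Module ℂ (weightedSubmodule V))

instance : CoeFun (WeightedLinf V) fun _ => E → ℂ := ⟨fun f => f.1⟩

@[ext] theorem ext {f g : WeightedLinf V} (h : ∀ x, f x = g x) : f = g :=
  Subtype.ext (funext h)

@[simp] theorem zero_apply (x : E) : (0 : WeightedLinf V) x = 0 := rfl
@[simp] theorem add_apply (f g : WeightedLinf V) (x : E) : (f + g) x = f x + g x := rfl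
@[simp] theorem neg_apply (f : WeightedLinf V) (x : E) : (-f) x = -f x := rfl
@[simp] theorem smul_apply (c : ℂ) (f : WeightedLinf V) (x : E) : (c • f) x = c • f x := rfl

theorem measurable (f : WeightedLinf V) : Measurable (f : E → ℂ) := f.2.1

/-- The weighted supremum norm `‖f‖_V = sup_x |f x| / V x`. -/
instance : Norm (WeightedLinf V) := ⟨fun f => ⨆ x, ‖f x‖ / V x⟩

theorem norm_def (f : WeightedLinf V) : ‖f‖ = ⨆ x, ‖f x‖ / V x := rfl

theorem bddAbove (f : WeightedLinf V) : BddAbove (Set.range fun x => ‖f x‖ / (V x : ℝ)) := by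
  obtain ⟨-, C, hC, hf⟩ := f.2
  refine ⟨C, ?_⟩
  rintro _ ⟨x, rfl⟩
  exact div_le_of_le_mul₀ (V x).2 hC.le (hf x)

theorem norm_apply_le (f : WeightedLinf V) (x : E) : ‖f x‖ ≤ ‖f‖ * V x := by
  rcases eq_or_ne (V x) 0 with h | h
  · obtain ⟨-, C, hC, hf⟩ := f.2
    simpa [h] using hf x
  · have hV : (0 : ℝ) < V x := by positivity
    rw [← div_le_iff₀ hV, norm_def]
    exact le_ciSup f.bddAbove x

theorem norm_le_of_forall {f : WeightedLinf V} {C : ℝ} (hC : 0 ≤ C)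
    (h : ∀ x, ‖f x‖ ≤ C * V x) : ‖f‖ ≤ C :=
  Real.iSup_le (fun x => div_le_of_le_mul₀ (V x).2 hC (h x)) hC

theorem norm_nonneg' (f : WeightedLinf V) : 0 ≤ ‖f‖ :=
  Real.iSup_nonneg fun x => by positivity

instance : NormedAddCommGroup (WeightedLinf V) :=
  AddGroupNorm.toNormedAddCommGroup
    { toFun := fun f => ‖f‖
      map_zero' := le_antisymm (norm_le_of_forall le_rfl fun x => by simp) (norm_nonneg' _)
      add_le' := fun f g => by
        refine norm_le_of_forall (add_nonneg f.norm_nonneg' g.norm_nonneg') fun x => ?_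
        rw [add_mul]
        exact (norm_add_le _ _).trans (add_le_add (f.norm_apply_le x) (g.norm_apply_le x))
      neg' := fun f => by simp only [norm_def, neg_apply, norm_neg]
      eq_zero_of_map_eq_zero' := fun f hf => by
        have hf' : ‖f‖ = 0 := hf
        ext x
        have := f.norm_apply_le x
        rw [hf', zero_mul] at this
        exact norm_le_zero_iff.1 this }

instance : NormedSpace ℂ (WeightedLinf V) where
  norm_smul_le c f := by
    refine norm_le_of_forall (mul_nonneg (norm_nonneg _) f.norm_nonneg') fun x => ?_
    rw [smul_apply, norm_smul, mul_assoc]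
    exact mul_le_mul_of_nonneg_left (f.norm_apply_le x) (norm_nonneg _)

/-- `f ≥ 0`: all values of `f` are nonnegative real numbers. -/
def Nonneg (f : WeightedLinf V) : Prop := ∀ x, 0 ≤ f x

/-- An operator on `L^∞(V)` is positive if it maps nonnegative functions to nonnegative ones. -/
def IsPositiveOp (K : WeightedLinf V →L[ℂ] WeightedLinf V) : Prop :=
  ∀ f : WeightedLinf V, f.Nonneg → (K f).Nonneg

end WeightedLinf

/-- `P` is a kernel from `E` to `L^∞(V)`: `‖P(·, V)‖_V < ∞`, that is, `P V ≤ C V` for a finite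
constant `C`. If `V > 0`, this forces every measure `P x` to be σ-finite. -/
def IsWeightedKernel (V : E → ℝ≥0) (P : Kernel E E) : Prop :=
  ∃ C : ℝ≥0, ∀ x, ∫⁻ y, V y ∂(P x) ≤ C * V x

theorem IsWeightedKernel.lintegral_enorm_le {V : E → ℝ≥0} {P : Kernel E E} {C : ℝ≥0}
    (hC : ∀ x, ∫⁻ y, V y ∂(P x) ≤ C * V x) (f : WeightedLinf V) (x : E) :
    ∫⁻ y, ‖f y‖ₑ ∂(P x) ≤ ENNReal.ofReal (C * ‖f‖ * V x) := by
  calc ∫⁻ y, ‖f y‖ₑ ∂(P x) ≤ ∫⁻ y, ENNReal.ofReal ‖f‖ * V y ∂(P x) := by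
        refine lintegral_mono fun y => ?_
        rw [← ofReal_norm, ← ENNReal.ofReal_coe_nnreal,
          ← ENNReal.ofReal_mul (norm_nonneg _)]
        exact ENNReal.ofReal_le_ofReal (f.norm_apply_le y)
    _ = ENNReal.ofReal ‖f‖ * ∫⁻ y, V y ∂(P x) := lintegral_const_mul' _ _ ENNReal.ofReal_ne_top
    _ ≤ ENNReal.ofReal ‖f‖ * (C * V x) := by gcongr; exact hC x
    _ = ENNReal.ofReal (C * ‖f‖ * V x) := by
        rw [ENNReal.ofReal_mul (by positivity), ENNReal.ofReal_mul (by positivity),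
          ENNReal.ofReal_coe_nnreal, ENNReal.ofReal_coe_nnreal]
        ring

theorem IsWeightedKernel.integrable {V : E → ℝ≥0} {P : Kernel E E} (hP : IsWeightedKernel V P)
    (f : WeightedLinf V) (x : E) : Integrable (fun y => f y) (P x) := by
  obtain ⟨C, hC⟩ := hP
  exact ⟨f.measurable.aestronglyMeasurable,
    (IsWeightedKernel.lintegral_enorm_le hC f x).trans_lt ENNReal.ofReal_lt_top⟩

theorem IsWeightedKernel.norm_integral_le {V : E → ℝ≥0} {P : Kernel E E} {C : ℝ≥0}
    (hC : ∀ x, ∫⁻ y, V y ∂(P x) ≤ C * V x) (f : WeightedLinf V) (x : E) :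
    ‖∫ y, f y ∂(P x)‖ ≤ C * ‖f‖ * V x := by
  have h := (enorm_integral_le_lintegral_enorm (μ := P x) (fun y => f y)).trans
    (IsWeightedKernel.lintegral_enorm_le hC f x)
  rw [← ofReal_norm] at h
  exact (ENNReal.ofReal_le_ofReal_iff (by positivity)).1 h

/-- The bounded operator `f ↦ (x ↦ ∫ f(y) P(x, dy))` on `L^∞(V)` induced by a kernel. -/
def kernelOp (V : E → ℝ≥0) (P : Kernel E E) (hP : IsWeightedKernel V P) :
    WeightedLinf V →L[ℂ] WeightedLinf V :=
  LinearMap.mkContinuousOfExistsBound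
    { toFun := fun f => ⟨fun x => ∫ y, f y ∂(P x), by
        obtain ⟨C, hC⟩ := hP
        refine ⟨f.measurable.stronglyMeasurable.integral_kernel.measurable,
          C * ‖f‖ + 1, by positivity, fun x => ?_⟩
        refine (IsWeightedKernel.norm_integral_le hC f x).trans ?_
        exact mul_le_mul_of_nonneg_right (by linarith) (V x).2⟩
      map_add' := fun f g => WeightedLinf.ext fun x =>
        integral_add (hP.integrable f x) (hP.integrable g x)
      map_smul' := fun c f => WeightedLinf.ext fun x => integral_smul c _ }
    (by
      obtain ⟨C, hC⟩ := hP
      exact ⟨C, fun f => WeightedLinf.norm_le_of_forall (by positivity)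
        fun x => IsWeightedKernel.norm_integral_le hC f x⟩)

theorem kernelOp_apply (V : E → ℝ≥0) (P : Kernel E E) (hP : IsWeightedKernel V P)
    (f : WeightedLinf V) (x : E) : kernelOp V P hP f x = ∫ y, f y ∂(P x) := rfl

end WeightedSpace

end

/-!
Normalizing `P` to `Q(x, dy) = V(x)⁻¹ P(x, dy) V(y)` turns `L^∞(V)` into the bounded functions.

Since `K` is compact, the functionals `f ↦ K f x / V x` are, up to `ε`, among finitely many of them
(`exists_finite_net_of_isCompactOperator`). Their sum is a single finitely additive set function
`m`, and the two hypotheses on `P` give `Q(x, s) ≤ m(s) + θ`, where `θ = max θ₁ θ₂ + ε`. The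
measures `Q(x, ·)` are countably additive, so `m` may be replaced by the measure `ν` obtained from
the outer measure it generates (`exists_measure_of_charge`).

As the σ-field is countably generated, `Q` has a jointly measurable density with respect to `ν`
off a singular part. Truncating it at one gives `Q = A + B`, where `A` has a density at most one
and `B` has mass at most `θ` (`exists_density_add_kernel`). Each word `A B ^ k A` is a norm limit
of compact operators (`HasDensity.mul_mul_mem_compactClosure`): the density of the last factor may
be replaced by a combination of indicators of rectangles that is close to it in an `L¹` sense only.
Hence, up to such limits, `(A + B) ^ n` is the sum of the words with at most one letter `A`, whose
norm is at most `θ ^ n + n ‖A‖ θ ^ (n - 1)`. So the essential spectral radius is at most `θ`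
(`essSpectralRadius_add_le`), and `ε → 0`. Quasi-compactness follows since `θ₁` and `θ₂` are less
than the spectral radius.
-/

/-! ### Sums of operators modulo compact operators -/

section Abstract

variable {X : Type*} [NormedAddCommGroup X] [NormedSpace ℂ X]

/-- The norm closure of the compact operators. On a Banach space this is again the set of compact
operators; working with the closure makes completeness of `X` unnecessary. -/
noncomputable def compactClosure (X : Type*) [NormedAddCommGroup X] [NormedSpace ℂ X] :
    AddSubgroup (X →L[ℂ] X) :=
  (compactOperator (RingHom.id ℂ) X X).toAddSubgroup.topologicalClosure

theorem compactClosure_mul_left (S : X →L[ℂ] X) {T : X →L[ℂ] X} (hT : T ∈ compactClosure X) :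
    S * T ∈ compactClosure X :=
  map_mem_closure (f := fun T => S * T) (continuous_const.mul continuous_id) hT
    fun _ h => IsCompactOperator.clm_comp (g := S) h

theorem compactClosure_mul_right (S : X →L[ℂ] X) {T : X →L[ℂ] X} (hT : T ∈ compactClosure X) :
    T * S ∈ compactClosure X :=
  map_mem_closure (f := fun T => T * S) (continuous_id.mul continuous_const) hT
    fun _ h => IsCompactOperator.comp_clm h S

theorem mem_compactClosure_of_forall {T : X →L[ℂ] X}
    (h : ∀ ε : ℝ, 0 < ε → ∃ S : X →L[ℂ] X, IsCompactOperator S ∧ ‖T - S‖ ≤ ε) :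
    T ∈ compactClosure X := by
  refine Metric.mem_closure_iff.2 fun ε hε => ?_
  obtain ⟨S, hS, hST⟩ := h (ε / 2) (half_pos hε)
  exact ⟨S, hS, by rw [dist_eq_norm]; linarith⟩

theorem distCompact_le_of_mem_compactClosure (T : X →L[ℂ] X) (n : ℕ) {S : X →L[ℂ] X}
    (hS : S ∈ compactClosure X) : distCompact T n ≤ ‖T ^ n - S‖ := by
  have hcl : IsClosed {S : X →L[ℂ] X | distCompact T n ≤ ‖T ^ n - S‖} :=
    isClosed_le continuous_const (continuous_const.sub continuous_id).norm
  exact closure_minimal (fun S hS => ciInf_le (bddBelow_distCompact T n) ⟨S, hS⟩) hcl hS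

/-- The part of `(A + B) ^ n` consisting of the words that contain exactly one letter `A`. -/
noncomputable def onceWords (A B : X →L[ℂ] X) : ℕ → (X →L[ℂ] X)
  | 0 => 0
  | n + 1 => A * B ^ n + B * onceWords A B n

theorem norm_pow_le_pow {B : X →L[ℂ] X} {θ : ℝ} (hB : ‖B‖ ≤ θ) (n : ℕ) : ‖B ^ n‖ ≤ θ ^ n := by
  induction n with
  | zero => rw [pow_zero, pow_zero]; exact ContinuousLinearMap.norm_id_le
  | succ n ih =>
    rw [pow_succ, pow_succ]
    exact (norm_mul_le _ _).trans
      (mul_le_mul ih hB (norm_nonneg _) (pow_nonneg ((norm_nonneg _).trans hB) _))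

/-- The bound `‖onceWords A B n‖ ≤ n ‖A‖ θ ^ (n - 1)`, multiplied by `θ` to avoid the exponent
`n - 1`. -/
theorem mul_norm_onceWords_le (A : X →L[ℂ] X) {B : X →L[ℂ] X} {θ : ℝ} (hB : ‖B‖ ≤ θ)
    (n : ℕ) : θ * ‖onceWords A B n‖ ≤ n * ‖A‖ * θ ^ n := by
  have hθ : 0 ≤ θ := (norm_nonneg _).trans hB
  induction n with
  | zero => simp [onceWords]
  | succ n ih =>
    have h1 : ‖A * B ^ n‖ ≤ ‖A‖ * θ ^ n := (norm_mul_le _ _).trans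
      (mul_le_mul_of_nonneg_left (norm_pow_le_pow hB n) (norm_nonneg _))
    have h2 : ‖B * onceWords A B n‖ ≤ n * ‖A‖ * θ ^ n := (norm_mul_le _ _).trans
      ((mul_le_mul_of_nonneg_right hB (norm_nonneg _)).trans ih)
    calc θ * ‖onceWords A B (n + 1)‖ ≤ θ * (‖A‖ * θ ^ n + n * ‖A‖ * θ ^ n) :=
          mul_le_mul_of_nonneg_left ((norm_add_le _ _).trans (add_le_add h1 h2)) hθ
      _ = (n + 1 : ℕ) * ‖A‖ * θ ^ (n + 1) := by push_cast; ring

theorem mul_pow_mul_onceWords_mem {A B : X →L[ℂ] X}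
    (hAB : ∀ k, A * B ^ k * A ∈ compactClosure X) (n k : ℕ) :
    A * B ^ k * onceWords A B n ∈ compactClosure X := by
  induction n generalizing k with
  | zero => simp [onceWords]
  | succ n ih =>
    have : A * B ^ k * onceWords A B (n + 1)
        = A * B ^ k * A * B ^ n + A * B ^ (k + 1) * onceWords A B n := by
      rw [onceWords, mul_add, pow_succ]; simp only [mul_assoc]
    rw [this]
    exact (compactClosure X).add_mem (compactClosure_mul_right _ (hAB k)) (ih (k + 1))

/-- If every word `A B ^ k A` is a limit of compact operators, then `(A + B) ^ n` agrees, up to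
such a limit, with the words that contain the letter `A` at most once. -/
theorem add_pow_sub_mem_compactClosure {A B : X →L[ℂ] X}
    (hAB : ∀ k, A * B ^ k * A ∈ compactClosure X) (n : ℕ) :
    (A + B) ^ n - (B ^ n + onceWords A B n) ∈ compactClosure X := by
  induction n with
  | zero => simp [onceWords]
  | succ n ih =>
    have h := (compactClosure X).add_mem (compactClosure_mul_left (A + B) ih)
      (by simpa using mul_pow_mul_onceWords_mem hAB n 0)
    convert h using 1
    rw [onceWords, pow_succ', pow_succ' B]
    noncomm_ring

theorem mul_distCompact_add_le {A B : X →L[ℂ] X} {θ : ℝ} (hB : ‖B‖ ≤ θ)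
    (hAB : ∀ k, A * B ^ k * A ∈ compactClosure X) (n : ℕ) :
    θ * distCompact (A + B) n ≤ (θ + n * ‖A‖) * θ ^ n := by
  have hθ : 0 ≤ θ := (norm_nonneg _).trans hB
  have h := distCompact_le_of_mem_compactClosure (A + B) n (add_pow_sub_mem_compactClosure hAB n)
  rw [sub_sub_cancel] at h
  calc θ * distCompact (A + B) n ≤ θ * (θ ^ n + ‖onceWords A B n‖) :=
        mul_le_mul_of_nonneg_left (h.trans ((norm_add_le _ _).trans
          (add_le_add_left (norm_pow_le_pow hB n) _))) hθ
    _ ≤ (θ + n * ‖A‖) * θ ^ n := by linarith [mul_norm_onceWords_le A hB n]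

/-- The essential spectral radius of `A + B` is at most `‖B‖` when every word `A B ^ k A` is a
limit of compact operators. -/
theorem essSpectralRadius_add_le {A B : X →L[ℂ] X} {θ : ℝ} (hθ : 0 < θ) (hB : ‖B‖ ≤ θ)
    (hAB : ∀ k, A * B ^ k * A ∈ compactClosure X) : essSpectralRadius (A + B) ≤ θ := by
  refine le_of_forall_gt_imp_ge_of_dense fun s hs => ?_
  have hs0 : 0 < s := hθ.trans hs
  refine le_of_tendsto (tendsto_essSpectralRadius (A + B)) ?_
  have hr0 : 0 ≤ θ / s := by positivity
  have hr1 : θ / s < 1 := (div_lt_one hs0).2 hs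
  have hlim : Tendsto (fun n : ℕ => θ * (θ / s) ^ n + ‖A‖ * (n * (θ / s) ^ n)) atTop (𝓝 0) := by
    simpa using ((tendsto_pow_atTop_nhds_zero_of_lt_one hr0 hr1).const_mul θ).add
      ((tendsto_self_mul_const_pow_of_lt_one hr0 hr1).const_mul ‖A‖)
  filter_upwards [hlim.eventually (gt_mem_nhds hθ), eventually_ge_atTop 1] with n hn hn1
  have hle : distCompact (A + B) n ≤ s ^ n := by
    refine le_of_mul_le_mul_left ((mul_distCompact_add_le hB hAB n).trans ?_) hθ
    have hsn : 0 < s ^ n := pow_pos hs0 n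
    have : (θ + n * ‖A‖) * θ ^ n = (θ * (θ / s) ^ n + ‖A‖ * (n * (θ / s) ^ n)) * s ^ n := by
      rw [div_pow]; field_simp
    rw [this]
    exact mul_le_mul_of_nonneg_right hn.le hsn.le
  rw [iInf_rpow_eq]
  calc distCompact (A + B) n ^ (1 / (n : ℝ)) ≤ (s ^ n) ^ (1 / (n : ℝ)) :=
        Real.rpow_le_rpow (distCompact_nonneg _ _) hle (by positivity)
    _ = s := by rw [one_div, Real.pow_rpow_inv_natCast hs0.le (by omega)]

end Abstract

/-! ### From finitely additive set functions to measures -/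

section Charge

variable {E : Type*} [MeasurableSpace E]

open Classical in
/-- The outer measure generated by a set function `m` on the measurable sets: the infimum of
`∑ᵢ m (Bᵢ)` over all countable measurable covers. -/
noncomputable def chargeOuterMeasure (m : Set E → ℝ≥0∞) (h0 : m ∅ = 0) : OuterMeasure E :=
  OuterMeasure.ofFunction (fun s => if MeasurableSet s then m s else ∞) (by simp [h0])

/-- For a finitely additive `m` there is a (countably additive) measure `ν`, generated by countable
covers, such that every measure `μ ≤ m + θ` satisfies `μ ≤ ν + θ`, for every constant `θ`. So the
purely finitely additive part of `m` does not help to dominate measures. -/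
theorem exists_measure_of_charge (m : Set E → ℝ≥0∞) (h0 : m ∅ = 0) (hfin : m Set.univ ≠ ∞)
    (hadd : ∀ s t, MeasurableSet s → MeasurableSet t → Disjoint s t → m (s ∪ t) = m s + m t) :
    ∃ ν : Measure E, IsFiniteMeasure ν ∧ ∀ (μ : Measure E) (θ : ℝ≥0∞),
      (∀ s, MeasurableSet s → μ s ≤ m s + θ) → ∀ s, MeasurableSet s → μ s ≤ ν s + θ := by
  classical
  have hcar : ‹MeasurableSpace E› ≤ (chargeOuterMeasure m h0).caratheodory := by
    intro s hs
    refine OuterMeasure.ofFunction_caratheodory fun t => ?_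
    by_cases ht : MeasurableSet t
    · rw [if_pos (ht.inter hs), if_pos (ht.diff hs), if_pos ht,
        ← hadd _ _ (ht.inter hs) (ht.diff hs) (Set.disjoint_sdiff_right.mono_left
          Set.inter_subset_right), Set.inter_union_sdiff]
    · rw [if_neg ht]; exact le_top
  refine ⟨(chargeOuterMeasure m h0).toMeasure hcar, ⟨?_⟩, fun μ θ hμ s hs => ?_⟩
  · rw [toMeasure_apply _ _ MeasurableSet.univ]
    refine (OuterMeasure.ofFunction_le _).trans_lt ?_
    rw [if_pos MeasurableSet.univ]
    exact hfin.lt_top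
  · rw [toMeasure_apply _ _ hs, chargeOuterMeasure, OuterMeasure.ofFunction_apply]
    simp only [ENNReal.iInf_add]
    refine le_iInf fun t => le_iInf fun hst => ?_
    by_cases ht : ∀ n, MeasurableSet (t n)
    swap
    · obtain ⟨n, hn⟩ := not_forall.1 ht
      rw [ENNReal.tsum_eq_top_of_eq_top ⟨n, if_neg hn⟩, top_add]
      exact le_top
    simp only [if_pos (ht _)]
    have hunion : ∀ n, MeasurableSet (Set.accumulate t n) := fun n =>
      .biUnion (Set.to_countable _) fun i _ => ht i
    have hmono : ∀ a b, MeasurableSet a → MeasurableSet b → m (a ∪ b) ≤ m a + m b := by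
      intro a b ha hb
      have hbd := hadd (a ∩ b) (b \ a) (ha.inter hb) (hb.diff ha)
        (Set.disjoint_sdiff_right.mono_left Set.inter_subset_left)
      rw [Set.inter_comm, Set.inter_union_sdiff] at hbd
      rw [← Set.union_sdiff_self, hadd _ _ ha (hb.diff ha) Set.disjoint_sdiff_right, hbd]
      gcongr
      exact le_add_self
    -- `m` is finitely subadditive, so a finite part of the cover can be treated with `m`.
    have hsum : ∀ n, m (Set.accumulate t n) ≤ ∑ i ∈ Finset.range (n + 1), m (t i) := by
      intro n
      induction n with
      | zero => simp
      | succ n ih =>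
        rw [Set.accumulate_succ, Finset.sum_range_succ]
        exact (hmono _ _ (hunion n) (ht _)).trans (by gcongr)
    -- `μ` is continuous from below.
    refine (measure_mono hst).trans ?_
    rw [← Set.iUnion_accumulate, (Set.monotone_accumulate).measure_iUnion]
    refine iSup_le fun n => (hμ _ (hunion n)).trans ?_
    gcongr
    exact (hsum n).trans (ENNReal.sum_le_tsum _)

end Charge

/-! ### Truncating the density of a kernel -/

section Decomposition

variable {E : Type*} [MeasurableSpace E]

/-- A finite kernel `Q` dominated by `ν + θ` is the sum of a kernel with density at most one with
respect to `ν` and of a kernel of total mass at most `θ`. A countably generated σ-field is what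
makes the density jointly measurable. -/
theorem exists_density_add_kernel [MeasurableSpace.CountablyGenerated E] (Q : Kernel E E)
    [IsFiniteKernel Q] (ν : Measure E) [IsFiniteMeasure ν] (θ : ℝ≥0∞)
    (hQ : ∀ x s, MeasurableSet s → Q x s ≤ ν s + θ) :
    ∃ (a : E → E → ℝ≥0) (B : Kernel E E), Measurable (Function.uncurry a) ∧
      (∀ x y, a x y ≤ 1) ∧ (∀ x, B x Set.univ ≤ θ) ∧
      ∀ x, Q x = ν.withDensity (fun y => a x y) + B x := by
  let η : Kernel E E := Kernel.const E ν
  let r : E → E → ℝ≥0∞ := Kernel.rnDeriv Q η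
  let c : E → E → ℝ≥0∞ := fun x y => min (r x y) 1
  have hr : Measurable (Function.uncurry r) := Kernel.measurable_rnDeriv Q η
  have hc : Measurable (Function.uncurry c) := hr.min measurable_const
  have hcr : ∀ x y, c x y ≤ r x y := fun x y => min_le_left _ _
  have hcoe : ∀ x y, ((c x y).toNNReal : ℝ≥0∞) = c x y := fun x y =>
    ENNReal.coe_toNNReal ((min_le_right _ _).trans_lt ENNReal.one_lt_top).ne
  have hrc : Measurable (Function.uncurry fun x y => r x y - c x y) := hr.sub hc
  let D : Kernel E E := Kernel.withDensity η fun x y => r x y - c x y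
  have hsum : Q = D + Kernel.withDensity η c + Kernel.singularPart Q η := by
    rw [Kernel.withDensity_sub_add_cancel hr hc fun x => Eventually.of_forall (hcr x)]
    exact (Kernel.rnDeriv_add_singularPart Q η).symm
  refine ⟨fun x y => (c x y).toNNReal, D + Kernel.singularPart Q η, hc.ennreal_toNNReal,
    fun x y => ?_, fun x => ?_, fun x => ?_⟩
  · rw [← ENNReal.coe_le_coe, hcoe]
    exact min_le_right _ _
  · -- Test the domination on the set where `Q x` exceeds `ν`.
    let N : Set E := Kernel.mutuallySingularSetSlice Q η x
    let S : Set E := {y | 1 < r x y} ∪ N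
    have hrx : Measurable (r x) := hr.of_uncurry_left
    have hS : MeasurableSet S :=
      (measurableSet_lt measurable_const hrx).union
        (Kernel.measurableSet_mutuallySingularSetSlice Q η x)
    have hN : ν N = 0 := Kernel.measure_mutuallySingularSetSlice Q η x
    have hsing : Kernel.singularPart Q η x Set.univ ≤ Kernel.singularPart Q η x S := by
      have h0 : Kernel.singularPart Q η x Nᶜ = 0 :=
        Kernel.singularPart_compl_mutuallySingularSetSlice Q η x
      calc Kernel.singularPart Q η x Set.univ
          ≤ Kernel.singularPart Q η x (S ∪ Nᶜ) := measure_mono fun y _ => by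
            by_cases hy : y ∈ N
            · exact Or.inl (Or.inr hy)
            · exact Or.inr hy
        _ ≤ Kernel.singularPart Q η x S + Kernel.singularPart Q η x Nᶜ := measure_union_le _ _
        _ = Kernel.singularPart Q η x S := by rw [h0, add_zero]
    have hdens : ν S + D x Set.univ ≤ Kernel.withDensity η r x S := by
      rw [Kernel.withDensity_apply' η hr, Kernel.withDensity_apply' η hrc,
        Measure.restrict_univ, Kernel.const_apply, ← lintegral_indicator hS,
        ← lintegral_indicator_one hS,
        ← lintegral_add_left (measurable_one.indicator hS)]
      refine lintegral_mono_ae ?_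
      filter_upwards [measure_eq_zero_iff_ae_notMem.1 hN] with y hyN
      by_cases hy : 1 < r x y
      · have hyS : y ∈ S := Or.inl hy
        rw [Set.indicator_of_mem hyS, Set.indicator_of_mem hyS]
        simp only [c, min_eq_right hy.le, Pi.one_apply]
        rw [add_tsub_cancel_of_le hy.le]
      · have hyS : y ∉ S := fun h => h.elim hy hyN
        rw [Set.indicator_of_notMem hyS, Set.indicator_of_notMem hyS]
        simp [c, min_eq_left (not_lt.1 hy)]
    refine (ENNReal.add_le_add_iff_left (measure_ne_top ν S)).1 (le_trans ?_ (hQ x S hS))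
    conv_rhs => rw [← Kernel.rnDeriv_add_singularPart Q η]
    change ν S + (D x Set.univ + Kernel.singularPart Q η x Set.univ)
      ≤ Kernel.withDensity η r x S + Kernel.singularPart Q η x S
    rw [← add_assoc]
    exact add_le_add hdens hsing
  · simp only [hcoe]
    conv_lhs => rw [hsum]
    change D x + Kernel.withDensity η c x + Kernel.singularPart Q η x = _ + (D x + _)
    rw [Kernel.withDensity_apply η hc, Kernel.const_apply]
    abel

end Decomposition

/-! ### Kernel operators on `L^∞(V)` -/

section WeightedOperators

variable {E : Type*} [MeasurableSpace E] {V : E → ℝ≥0}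

namespace WeightedLinf

theorem norm_div_le (f : WeightedLinf V) (x : E) : ‖f x / ((V x : ℝ) : ℂ)‖ ≤ ‖f‖ := by
  rw [norm_div, Complex.norm_real, Real.norm_of_nonneg (V x).coe_nonneg]
  exact div_le_of_le_mul₀ (V x).2 (norm_nonneg f) (f.norm_apply_le x)

theorem measurable_div (hV : Measurable V) (f : WeightedLinf V) :
    Measurable fun x => f x / ((V x : ℝ) : ℂ) :=
  f.measurable.div (Complex.measurable_ofReal.comp hV.coe_nnreal_real)

theorem integrable_div (hV : Measurable V) (f : WeightedLinf V) (μ : Measure E)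
    [IsFiniteMeasure μ] : Integrable (fun x => f x / ((V x : ℝ) : ℂ)) μ :=
  .of_bound (f.measurable_div hV).aestronglyMeasurable ‖f‖ (Eventually.of_forall f.norm_div_le)

/-- The element `V 1_s` of `L^∞(V)`. -/
noncomputable def weightIndicator (hV : Measurable V) {s : Set E} (hs : MeasurableSet s) :
    WeightedLinf V :=
  ⟨s.indicator fun x => ((V x : ℝ) : ℂ),
    (Complex.measurable_ofReal.comp hV.coe_nnreal_real).indicator hs, 1, one_pos, fun x => by
      refine (norm_indicator_le_norm_self _ _).trans ?_
      simp⟩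

theorem weightIndicator_apply (hV : Measurable V) {s : Set E} (hs : MeasurableSet s) (x : E) :
    weightIndicator hV hs x = s.indicator (fun x => ((V x : ℝ) : ℂ)) x := rfl

theorem norm_weightIndicator_le (hV : Measurable V) {s : Set E} (hs : MeasurableSet s) :
    ‖weightIndicator hV hs‖ ≤ 1 :=
  norm_le_of_forall zero_le_one fun x => by
    rw [weightIndicator_apply]
    exact (norm_indicator_le_norm_self _ _).trans (by simp)

theorem weightIndicator_nonneg (hV : Measurable V) {s : Set E} (hs : MeasurableSet s) :
    (weightIndicator hV hs).Nonneg := fun x => by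
  rw [weightIndicator_apply]
  exact Set.indicator_nonneg (fun y _ => Complex.zero_le_real.2 (V y).2) x

theorem weightIndicator_union (hV : Measurable V) {s t : Set E} (hs : MeasurableSet s)
    (ht : MeasurableSet t) (hst : Disjoint s t) :
    weightIndicator hV (hs.union ht) = weightIndicator hV hs + weightIndicator hV ht :=
  WeightedLinf.ext fun x => by
    rw [add_apply, weightIndicator_apply, weightIndicator_apply, weightIndicator_apply,
      Set.indicator_union_of_disjoint hst]

/-- The continuous linear functional `f ↦ ∫ f / V dμ`. -/
noncomputable def weightedIntegral (hV : Measurable V) (μ : Measure E) [IsFiniteMeasure μ] :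
    WeightedLinf V →L[ℂ] ℂ :=
  LinearMap.mkContinuous
    { toFun := fun f => ∫ x, f x / ((V x : ℝ) : ℂ) ∂μ
      map_add' := fun f g => by
        simp only [add_apply, add_div]
        exact integral_add (f.integrable_div hV μ) (g.integrable_div hV μ)
      map_smul' := fun c f => by
        simp only [smul_apply, smul_eq_mul, mul_div_assoc, RingHom.id_apply]
        exact integral_const_mul c _ }
    (μ.real Set.univ) fun f => by
      rw [mul_comm]
      exact norm_integral_le_of_norm_le_const (Eventually.of_forall f.norm_div_le)

theorem weightedIntegral_apply (hV : Measurable V) (μ : Measure E) [IsFiniteMeasure μ]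
    (f : WeightedLinf V) : weightedIntegral hV μ f = ∫ x, f x / ((V x : ℝ) : ℂ) ∂μ := rfl

theorem norm_weightedIntegral_le (hV : Measurable V) (μ : Measure E) [IsFiniteMeasure μ] {c : ℝ}
    (hc : 0 ≤ c) (hμ : μ Set.univ ≤ ENNReal.ofReal c) (f : WeightedLinf V) :
    ‖weightedIntegral hV μ f‖ ≤ c * ‖f‖ := by
  refine (norm_integral_le_of_norm_le_const (Eventually.of_forall f.norm_div_le)).trans ?_
  rw [mul_comm]
  exact mul_le_mul_of_nonneg_right (ENNReal.toReal_le_of_le_ofReal hc hμ) (norm_nonneg _)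

end WeightedLinf

open WeightedLinf

/-- The operator `f ↦ (x ↦ V x * ∫ f / V dR x)` on `L^∞(V)` induced by a finite kernel `R`: the
operator of `R` on bounded functions, transported along the isometry `f ↦ V f`. -/
noncomputable def weightedKernelOp (hV : Measurable V) (R : Kernel E E) [IsFiniteKernel R] :
    WeightedLinf V →L[ℂ] WeightedLinf V :=
  have hbound : ∀ (f : WeightedLinf V) (x : E),
      ‖((V x : ℝ) : ℂ) * weightedIntegral hV (R x) f‖ ≤ R.bound.toReal * ‖f‖ * V x := fun f x => by
    rw [norm_mul, Complex.norm_real, Real.norm_of_nonneg (V x).coe_nonneg, mul_comm]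
    refine mul_le_mul_of_nonneg_right (norm_weightedIntegral_le hV _ ENNReal.toReal_nonneg ?_ f)
      (V x).2
    rw [ENNReal.ofReal_toReal (Kernel.bound_ne_top R)]
    exact Kernel.measure_le_bound R x _
  LinearMap.mkContinuous
    { toFun := fun f => ⟨fun x => ((V x : ℝ) : ℂ) * weightedIntegral hV (R x) f, by
        refine ⟨(Complex.measurable_ofReal.comp hV.coe_nnreal_real).mul
          (f.measurable_div hV).stronglyMeasurable.integral_kernel.measurable,
          R.bound.toReal * ‖f‖ + 1, by positivity, fun x => (hbound f x).trans ?_⟩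
        exact mul_le_mul_of_nonneg_right (by linarith) (V x).2⟩
      map_add' := fun f g => WeightedLinf.ext fun x => by
        change _ * weightedIntegral hV (R x) (f + g) = _ * _ + _ * _
        rw [map_add, mul_add]
      map_smul' := fun c f => WeightedLinf.ext fun x => by
        change _ * weightedIntegral hV (R x) (c • f) = c • (_ * _)
        rw [map_smul, mul_smul_comm] }
    R.bound.toReal fun f => norm_le_of_forall (by positivity) (hbound f)

theorem weightedKernelOp_apply (hV : Measurable V) (R : Kernel E E) [IsFiniteKernel R]
    (f : WeightedLinf V) (x : E) :
    weightedKernelOp hV R f x = ((V x : ℝ) : ℂ) * ∫ y, f y / ((V y : ℝ) : ℂ) ∂(R x) := rfl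

theorem norm_weightedKernelOp_le (hV : Measurable V) (R : Kernel E E) [IsFiniteKernel R] {c : ℝ}
    (hc : 0 ≤ c) (hR : ∀ x, R x Set.univ ≤ ENNReal.ofReal c) : ‖weightedKernelOp hV R‖ ≤ c := by
  refine ContinuousLinearMap.opNorm_le_bound _ hc fun f => norm_le_of_forall (by positivity)
    fun x => ?_
  change ‖((V x : ℝ) : ℂ) * weightedIntegral hV (R x) f‖ ≤ _
  rw [norm_mul, Complex.norm_real, Real.norm_of_nonneg (V x).coe_nonneg, mul_comm]
  exact mul_le_mul_of_nonneg_right (norm_weightedIntegral_le hV _ hc (hR x) f) (V x).2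

/-! ### Operators that act on `L¹` seminorms -/

/-- Every `L¹(μ)`-seminorm of `W f / V` is bounded by an `L¹(ρ)`-seminorm of `f / V`, with finite
measures `μ` and `ρ`. This holds for operators given by kernels and is stable under products. -/
def DominatesL1 (W : WeightedLinf V →L[ℂ] WeightedLinf V) : Prop :=
  ∀ (μ : Measure E) [IsFiniteMeasure μ], ∃ ρ : Measure E, IsFiniteMeasure ρ ∧
    ∀ f : WeightedLinf V, ∫⁻ x, ‖W f x / ((V x : ℝ) : ℂ)‖ₑ ∂μ ≤ ∫⁻ x, ‖f x / ((V x : ℝ) : ℂ)‖ₑ ∂ρ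

theorem DominatesL1.pow {W : WeightedLinf V →L[ℂ] WeightedLinf V} (hW : DominatesL1 W) (n : ℕ) :
    DominatesL1 (W ^ n) := by
  induction n with
  | zero => exact fun μ hμ => ⟨μ, hμ, fun f => by simp⟩
  | succ n ih =>
    intro μ hμ
    obtain ⟨ρ, hρ, h1⟩ := ih μ
    obtain ⟨ρ', hρ', h2⟩ := hW ρ
    refine ⟨ρ', hρ', fun f => ?_⟩
    rw [pow_succ]
    exact (h1 (W f)).trans (h2 f)

theorem dominatesL1_weightedKernelOp (hV : Measurable V) (hVpos : ∀ x, 0 < V x) (R : Kernel E E)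
    [IsFiniteKernel R] : DominatesL1 (weightedKernelOp hV R) := by
  intro μ hμ
  refine ⟨μ.bind R, inferInstance, fun f => ?_⟩
  rw [Measure.lintegral_bind R.aemeasurable (f.measurable_div hV).enorm.aemeasurable]
  refine lintegral_mono fun x => ?_
  have hx : ((V x : ℝ) : ℂ) ≠ 0 := by
    exact_mod_cast (hVpos x).ne'
  rw [weightedKernelOp_apply, mul_div_cancel_left₀ _ hx]
  exact enorm_integral_le_lintegral_enorm _

/-! ### Operators with a bounded density -/

/-- `T f x = V x * ∫ k (x, y) (f y / V y) dν(y)`. -/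
def HasDensity (T : WeightedLinf V →L[ℂ] WeightedLinf V) (ν : Measure E) (k : E × E → ℂ) : Prop :=
  ∀ f x, T f x = ((V x : ℝ) : ℂ) * ∫ y, k (x, y) * (f y / ((V y : ℝ) : ℂ)) ∂ν

/-- `k` is a bounded measurable density of a compact operator on `L^∞(V)`. -/
def IsCompactDensity (V : E → ℝ≥0) (ν : Measure E) (k : E × E → ℂ) : Prop :=
  Measurable k ∧ (∃ C : ℝ, ∀ p, ‖k p‖ ≤ C) ∧
    ∃ T : WeightedLinf V →L[ℂ] WeightedLinf V, IsCompactOperator T ∧ HasDensity T ν k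

theorem integrable_density_mul (hV : Measurable V) {ν : Measure E} [IsFiniteMeasure ν]
    {k : E × E → ℂ} (hk : Measurable k) {C : ℝ} (hC : ∀ p, ‖k p‖ ≤ C) (f : WeightedLinf V)
    (x : E) : Integrable (fun y => k (x, y) * (f y / ((V y : ℝ) : ℂ))) ν :=
  (f.integrable_div hV ν).bdd_mul (c := C) (hk.comp measurable_prodMk_left).aestronglyMeasurable
    (Eventually.of_forall fun _ => hC _)

theorem HasDensity.sub (hV : Measurable V) {ν : Measure E} [IsFiniteMeasure ν]
    {S T : WeightedLinf V →L[ℂ] WeightedLinf V} {k l : E × E → ℂ} (hS : HasDensity S ν k)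
    (hT : HasDensity T ν l) (hk : Measurable k) (hl : Measurable l) {C D : ℝ}
    (hC : ∀ p, ‖k p‖ ≤ C) (hD : ∀ p, ‖l p‖ ≤ D) : HasDensity (S - T) ν (k - l) := by
  intro f x
  have h : (S - T) f x = S f x - T f x := by
    rw [_root_.sub_apply, sub_eq_add_neg, sub_eq_add_neg]; rfl
  rw [h, hS, hT, ← mul_sub, ← integral_sub (integrable_density_mul hV hk hC f x)
    (integrable_density_mul hV hl hD f x)]
  simp only [Pi.sub_apply, sub_mul]

theorem IsCompactDensity.add (hV : Measurable V) {ν : Measure E} [IsFiniteMeasure ν]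
    {k l : E × E → ℂ} (hk : IsCompactDensity V ν k) (hl : IsCompactDensity V ν l) :
    IsCompactDensity V ν (k + l) := by
  obtain ⟨hkm, ⟨C, hC⟩, S, hSc, hS⟩ := hk
  obtain ⟨hlm, ⟨D, hD⟩, T, hTc, hT⟩ := hl
  refine ⟨hkm.add hlm, ⟨C + D, fun p => (norm_add_le _ _).trans (add_le_add (hC p) (hD p))⟩,
    S + T, hSc.add hTc, fun f x => ?_⟩
  rw [_root_.add_apply, WeightedLinf.add_apply, hS, hT, ← mul_add,
    ← integral_add (integrable_density_mul hV hkm hC f x) (integrable_density_mul hV hlm hD f x)]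
  simp only [Pi.add_apply, add_mul]

theorem IsCompactDensity.const_smul {ν : Measure E} {k : E × E → ℂ}
    (hk : IsCompactDensity V ν k) (c : ℂ) : IsCompactDensity V ν (c • k) := by
  obtain ⟨hkm, ⟨C, hC⟩, S, hSc, hS⟩ := hk
  refine ⟨hkm.const_smul c, ⟨‖c‖ * C, fun p => ?_⟩, c • S, hSc.smul c, fun f x => ?_⟩
  · rw [Pi.smul_apply, norm_smul]
    exact mul_le_mul_of_nonneg_left (hC p) (norm_nonneg _)
  · rw [_root_.smul_apply, WeightedLinf.smul_apply, hS]
    simp only [Pi.smul_apply, smul_eq_mul, mul_assoc, integral_const_mul]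
    ring

/-- The indicator of a rectangle is the density of an operator of rank one. -/
theorem isCompactDensity_indicator_prod (hV : Measurable V) (ν : Measure E) [IsFiniteMeasure ν]
    {s t : Set E} (hs : MeasurableSet s) (ht : MeasurableSet t) :
    IsCompactDensity V ν ((s ×ˢ t).indicator fun _ => 1) := by
  refine ⟨measurable_const.indicator (hs.prod ht), ⟨1, fun p =>
    (norm_indicator_le_norm_self _ _).trans (by simp)⟩,
    (ContinuousLinearMap.toSpanSingleton ℂ (weightIndicator hV hs)).comp
      (weightedIntegral hV (ν.restrict t)), ?_, fun f x => ?_⟩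
  · exact (isCompactOperator_of_locallyCompactSpace_rng (ContinuousLinearMap.toSpanSingleton ℂ
      (weightIndicator hV hs))).comp_clm (weightedIntegral hV (ν.restrict t))
  · change weightedIntegral hV (ν.restrict t) f • weightIndicator hV hs x = _
    rw [weightedIntegral_apply, weightIndicator_apply, smul_eq_mul, mul_comm]
    by_cases hx : x ∈ s
    · rw [Set.indicator_of_mem hx, ← integral_indicator ht]
      congr 2 with y
      by_cases hy : y ∈ t <;> simp [hx, hy]
    · simp [hx]

end WeightedOperators

/-! ### Compactness of products with a density -/

section Approximation

variable {E : Type*} [MeasurableSpace E] {V : E → ℝ≥0}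

open WeightedLinf

/-- The indicator of a measurable set is approximated in `L¹` by sums of indicators of
rectangles. -/
theorem exists_isCompactDensity_indicator (hV : Measurable V) (ν : Measure E) [IsFiniteMeasure ν]
    (μ : Measure (E × E)) [IsFiniteMeasure μ] {s : Set (E × E)} (hs : MeasurableSet s) :
    ∀ ε : ℝ≥0∞, ε ≠ 0 →
      ∃ g, eLpNorm (g - s.indicator fun _ => (1 : ℂ)) 1 μ ≤ ε ∧ IsCompactDensity V ν g := by
  induction s, hs using MeasurableSpace.induction_on_inter generateFrom_prod.symm
    isPiSystem_prod with
  | empty => exact fun ε _ => ⟨0, by simp, by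
      simpa using (isCompactDensity_indicator_prod (V := V) hV ν .empty .empty).const_smul 0⟩
  | basic t ht =>
    obtain ⟨a, ha, b, hb, rfl⟩ := ht
    exact fun ε _ => ⟨_, by simp, isCompactDensity_indicator_prod hV ν ha hb⟩
  | compl t ht ih =>
    intro ε hε
    obtain ⟨g, hg, hgc⟩ := ih ε hε
    refine ⟨((Set.univ ×ˢ Set.univ).indicator fun _ => 1) + (-1 : ℂ) • g, ?_,
      (isCompactDensity_indicator_prod hV ν .univ .univ).add hV (hgc.const_smul _)⟩
    refine le_of_eq_of_le ?_ hg
    rw [← eLpNorm_neg]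
    congr 1
    ext p
    by_cases hp : p ∈ t <;> simp [hp, ← sub_eq_add_neg]
  | iUnion f hd hf ih =>
    intro ε hε
    have hε2 : ε / 2 ≠ 0 := (ENNReal.half_pos hε).ne'
    -- Only finitely many of the sets matter up to `ε / 2`.
    obtain ⟨n, hn⟩ : ∃ n, μ ((⋃ i, f i) \ Set.accumulate f n) ≤ ε / 2 := by
      have h := tendsto_measure_iInter_atTop (μ := μ)
        (s := fun n => (⋃ i, f i) \ Set.accumulate f n)
        (fun n => ((MeasurableSet.iUnion hf).diff
          (.biUnion (Set.to_countable _) fun i _ => hf i)).nullMeasurableSet)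
        (fun a b hab => Set.sdiff_subset_sdiff_right (Set.monotone_accumulate hab))
        ⟨0, measure_ne_top _ _⟩
      rw [← Set.sdiff_iUnion, Set.iUnion_accumulate, Set.sdiff_self, measure_empty] at h
      exact ((h.eventually (gt_mem_nhds (ENNReal.half_pos hε))).exists).imp fun _ h => h.le
    have hfin : ∀ m, ∀ δ : ℝ≥0∞, δ ≠ 0 → ∃ g,
        eLpNorm (g - (Set.accumulate f m).indicator fun _ => (1 : ℂ)) 1 μ ≤ δ ∧
          IsCompactDensity V ν g := by
      intro m
      induction m with
      | zero =>
        intro δ hδ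
        simpa using ih 0 δ hδ
      | succ m ihm =>
        intro δ hδ
        obtain ⟨g, hg, hgc⟩ := ihm (δ / 2) (ENNReal.half_pos hδ).ne'
        obtain ⟨g', hg', hgc'⟩ := ih (m + 1) (δ / 2) (ENNReal.half_pos hδ).ne'
        refine ⟨g + g', ?_, hgc.add hV hgc'⟩
        have hdisj : Disjoint (Set.accumulate f m) (f (m + 1)) :=
          Set.disjoint_accumulate hd (Nat.lt_succ_self m)
        rw [Set.accumulate_succ, Set.indicator_union_of_disjoint hdisj,
          show (g + g' - fun a => (Set.accumulate f m).indicator (fun _ => (1 : ℂ)) a +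
            (f (m + 1)).indicator (fun _ => (1 : ℂ)) a) =
            (g - (Set.accumulate f m).indicator fun _ => (1 : ℂ)) +
              (g' - (f (m + 1)).indicator fun _ => (1 : ℂ)) by ext p; simp; ring]
        refine (eLpNorm_add_le ?_ ?_ le_rfl).trans ((add_le_add hg hg').trans
          (ENNReal.add_halves δ).le)
        · exact (hgc.1.sub (measurable_const.indicator
            (.biUnion (Set.to_countable _) fun i _ => hf i))).aestronglyMeasurable
        · exact (hgc'.1.sub (measurable_const.indicator (hf _))).aestronglyMeasurable
    obtain ⟨g, hg, hgc⟩ := hfin n (ε / 2) hε2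
    refine ⟨g, ?_, hgc⟩
    have hacc : MeasurableSet (Set.accumulate f n) :=
      .biUnion (Set.to_countable _) fun i _ => hf i
    have hdiff : MeasurableSet ((⋃ i, f i) \ Set.accumulate f n) :=
      (MeasurableSet.iUnion hf).diff hacc
    have hsub : Set.accumulate f n ⊆ ⋃ i, f i := Set.accumulate_subset_iUnion n
    have hsplit : (g - (⋃ i, f i).indicator fun _ => (1 : ℂ)) =
        (g - (Set.accumulate f n).indicator fun _ => (1 : ℂ)) -
          ((⋃ i, f i) \ Set.accumulate f n).indicator fun _ => (1 : ℂ) := by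
      rw [Set.indicator_sdiff hsub]
      abel
    rw [hsplit]
    refine (eLpNorm_sub_le (hgc.1.sub (measurable_const.indicator hacc)).aestronglyMeasurable
      (measurable_const.indicator hdiff).aestronglyMeasurable le_rfl).trans
      ((add_le_add hg ?_).trans (ENNReal.add_halves ε).le)
    rw [eLpNorm_indicator_const hdiff one_ne_zero ENNReal.one_ne_top]
    simpa using hn

theorem exists_isCompactDensity (hV : Measurable V) (ν : Measure E) [IsFiniteMeasure ν]
    (μ : Measure (E × E)) [IsFiniteMeasure μ] {k : E × E → ℂ} (hk : Measurable k) {C : ℝ}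
    (hC : ∀ p, ‖k p‖ ≤ C) {ε : ℝ≥0∞} (hε : ε ≠ 0) :
    ∃ g, eLpNorm (k - g) 1 μ ≤ ε ∧ IsCompactDensity V ν g := by
  refine MemLp.induction_dense ENNReal.one_ne_top (IsCompactDensity V ν) ?_
    (fun f g hf hg => hf.add hV hg) (fun f hf => hf.1.aestronglyMeasurable)
    (MemLp.of_bound hk.aestronglyMeasurable C (Eventually.of_forall hC)) hε
  intro c s hs _ ε hε
  rcases eq_or_ne c 0 with rfl | hc
  · obtain ⟨g, -, hg⟩ := exists_isCompactDensity_indicator hV ν μ hs 1 one_ne_zero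
    exact ⟨(0 : ℂ) • g, by simp, hg.const_smul 0⟩
  have hc' : ‖c‖ₑ ≠ 0 := by simpa using hc
  obtain ⟨g, hg, hgc⟩ := exists_isCompactDensity_indicator hV ν μ hs (ε / ‖c‖ₑ)
    (ENNReal.div_ne_zero.2 ⟨hε, enorm_ne_top⟩)
  refine ⟨c • g, ?_, hgc.const_smul c⟩
  have : (c • g - s.indicator fun _ => c) = c • (g - s.indicator fun _ => (1 : ℂ)) := by
    ext p
    by_cases hp : p ∈ s <;> simp [hp, mul_sub]
  rw [this, eLpNorm_const_smul]
  exact (mul_le_mul_right hg _).trans ENNReal.mul_div_le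

theorem HasDensity.enorm_apply_le {T : WeightedLinf V →L[ℂ] WeightedLinf V} {ν : Measure E}
    {k : E × E → ℂ} (hT : HasDensity T ν k) (f : WeightedLinf V) (x : E) :
    ‖T f x‖ₑ ≤ V x * ∫⁻ y, ‖k (x, y)‖ₑ * ‖f y / ((V y : ℝ) : ℂ)‖ₑ ∂ν := by
  rw [hT, enorm_mul]
  gcongr
  · rw [← ofReal_norm, Complex.norm_real, Real.norm_of_nonneg (V x).coe_nonneg,
      ENNReal.ofReal_coe_nnreal]
  · refine (enorm_integral_le_lintegral_enorm _).trans (le_of_eq ?_)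
    simp only [enorm_mul]

/-- If `A` has a bounded density, then `A W A` is a limit of compact operators. Indeed, a
perturbation of the second density that is small in `L¹` only, and not uniformly, changes
`A W A` little in norm, since the first factor `A` integrates. -/
theorem HasDensity.mul_mul_mem_compactClosure (hV : Measurable V) (hVpos : ∀ x, 0 < V x)
    {ν : Measure E} [IsFiniteMeasure ν] {A W : WeightedLinf V →L[ℂ] WeightedLinf V}
    {k : E × E → ℂ} (hA : HasDensity A ν k) (hk : Measurable k) (hk1 : ∀ p, ‖k p‖ ≤ 1)
    (hW : DominatesL1 W) : A * W * A ∈ compactClosure (WeightedLinf V) := by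
  refine mem_compactClosure_of_forall fun ε hε => ?_
  obtain ⟨ρ, hρ, hWρ⟩ := hW ν
  obtain ⟨g, hg, hgm, ⟨D, hD⟩, S, hSc, hS⟩ :=
    exists_isCompactDensity hV ν (ρ.prod ν) hk hk1 (ENNReal.ofReal_pos.2 hε).ne'
  rw [eLpNorm_one_eq_lintegral_enorm,
    lintegral_prod _ (hk.sub hgm).enorm.aemeasurable] at hg
  refine ⟨A * W * S, hSc.clm_comp (A * W), ?_⟩
  rw [← mul_sub]
  have hAS := hA.sub hV hS hk hgm hk1 hD
  refine ContinuousLinearMap.opNorm_le_bound _ hε.le fun f =>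
    norm_le_of_forall (by positivity) fun x => ?_
  have hdiv : ∀ (h : WeightedLinf V) (c : ℝ≥0∞) (y : E), ‖h y‖ₑ ≤ V y * c →
      ‖h y / ((V y : ℝ) : ℂ)‖ₑ ≤ c := by
    intro h c y hy
    have hVy : ‖((V y : ℝ) : ℂ)‖ₑ = V y := by
      rw [← ofReal_norm, Complex.norm_real, Real.norm_of_nonneg (V y).coe_nonneg,
        ENNReal.ofReal_coe_nnreal]
    have h0 : ((V y : ℝ) : ℂ) ≠ 0 := by exact_mod_cast (hVpos y).ne'
    have hmul : ‖h y‖ₑ = V y * ‖h y / ((V y : ℝ) : ℂ)‖ₑ := by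
      rw [← hVy, ← enorm_mul, mul_div_cancel₀ _ h0]
    rw [hmul] at hy
    exact (ENNReal.mul_le_mul_iff_right (by exact_mod_cast (hVpos y).ne') ENNReal.coe_ne_top).1 hy
  have hkey : ‖(A * W * (A - S)) f x‖ₑ ≤ V x * (ENNReal.ofReal ε * ENNReal.ofReal ‖f‖) := by
    calc ‖(A * W * (A - S)) f x‖ₑ
        ≤ V x * ∫⁻ y, ‖k (x, y)‖ₑ * ‖W ((A - S) f) y / ((V y : ℝ) : ℂ)‖ₑ ∂ν :=
          hA.enorm_apply_le (W ((A - S) f)) x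
      _ ≤ V x * ∫⁻ y, ‖W ((A - S) f) y / ((V y : ℝ) : ℂ)‖ₑ ∂ν := by
          gcongr with y
          refine mul_le_of_le_one_left zero_le ?_
          rw [← ofReal_norm]
          exact ENNReal.ofReal_le_one.2 (hk1 _)
      _ ≤ V x * ∫⁻ w, ‖(A - S) f w / ((V w : ℝ) : ℂ)‖ₑ ∂ρ := by
          exact mul_le_mul_right (hWρ _) _
      _ ≤ V x * ∫⁻ w, (∫⁻ z, ‖(k - g) (w, z)‖ₑ ∂ν) * ENNReal.ofReal ‖f‖ ∂ρ := by
          gcongr with w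
          refine hdiv _ _ _ ((hAS.enorm_apply_le f w).trans ?_)
          rw [← lintegral_mul_const' _ _ ENNReal.ofReal_ne_top]
          gcongr with z
          rw [← ofReal_norm]
          exact ENNReal.ofReal_le_ofReal (f.norm_div_le z)
      _ ≤ V x * (ENNReal.ofReal ε * ENNReal.ofReal ‖f‖) := by
          rw [lintegral_mul_const' _ _ ENNReal.ofReal_ne_top]
          gcongr
  rw [← ofReal_norm, ← ENNReal.ofReal_mul hε.le, ← ENNReal.ofReal_coe_nnreal,
    ← ENNReal.ofReal_mul (V x).coe_nonneg, mul_comm] at hkey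
  exact (ENNReal.ofReal_le_ofReal_iff (by positivity)).1 hkey

end Approximation

/-! ### Reduction of the hypotheses to a dominating measure -/

section Reduction

variable {E : Type*} [MeasurableSpace E] {V : E → ℝ≥0}

open WeightedLinf

/-- The kernel `V(x)⁻¹ P(x, dy) V(y)`, which acts on bounded functions as `P` acts on `L^∞(V)`. -/
noncomputable def normalizedKernel (hV : Measurable V) (P : Kernel E E) : Kernel E E where
  toFun x := (V x)⁻¹ • (P x).withDensity fun y => V y
  measurable' := by
    refine Measure.measurable_of_measurable_coe _ fun s hs => ?_
    have h : Measurable fun x => ∫⁻ y, s.indicator (fun y => (V y : ℝ≥0∞)) y ∂(P x) :=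
      (hV.coe_nnreal_ennreal.indicator hs).lintegral_kernel
    simp only [Measure.smul_apply, withDensity_apply _ hs, ← lintegral_indicator hs]
    exact hV.inv.smul h

theorem normalizedKernel_apply (hV : Measurable V) (P : Kernel E E) (x : E) :
    normalizedKernel hV P x = (V x)⁻¹ • (P x).withDensity fun y => (V y : ℝ≥0∞) := rfl

theorem normalizedKernel_univ_le (hV : Measurable V) (P : Kernel E E) {x : E} (hx : 0 < V x)
    {c : ℝ≥0∞} (h : ∫⁻ y, V y ∂(P x) ≤ c * V x) : normalizedKernel hV P x Set.univ ≤ c := by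
  rw [normalizedKernel_apply, Measure.smul_apply, withDensity_apply _ .univ,
    Measure.restrict_univ, ENNReal.smul_def, smul_eq_mul, ENNReal.coe_inv hx.ne', mul_comm,
    ← div_eq_mul_inv]
  exact ENNReal.div_le_of_le_mul h

theorem isFiniteKernel_normalizedKernel (hV : Measurable V) (hVpos : ∀ x, 0 < V x)
    {P : Kernel E E} (hP : IsWeightedKernel V P) : IsFiniteKernel (normalizedKernel hV P) := by
  obtain ⟨C, hC⟩ := hP
  exact ⟨C, ENNReal.coe_lt_top, fun x => normalizedKernel_univ_le hV P (hVpos x) (hC x)⟩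

theorem kernelOp_eq_weightedKernelOp (hV : Measurable V) (hVpos : ∀ x, 0 < V x)
    (P : Kernel E E) (hP : IsWeightedKernel V P) [IsFiniteKernel (normalizedKernel hV P)] :
    kernelOp V P hP = weightedKernelOp hV (normalizedKernel hV P) := by
  ext f x
  have h0 : ∀ y, ((V y : ℝ) : ℂ) ≠ 0 := fun y => by exact_mod_cast (hVpos y).ne'
  rw [kernelOp_apply, weightedKernelOp_apply, normalizedKernel_apply,
    integral_smul_nnreal_measure, integral_withDensity_eq_integral_smul hV]
  simp only [NNReal.smul_def, Complex.real_smul, mul_div_cancel₀ _ (h0 _)]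
  rw [NNReal.coe_inv, Complex.ofReal_inv, mul_inv_cancel_left₀ (h0 x)]

theorem weightedKernelOp_weightIndicator (hV : Measurable V) (hVpos : ∀ x, 0 < V x)
    (R : Kernel E E) [IsFiniteKernel R] {s : Set E} (hs : MeasurableSet s) (x : E) :
    weightedKernelOp hV R (weightIndicator hV hs) x = ((V x * (R x).real s : ℝ) : ℂ) := by
  have h : (fun y => weightIndicator hV hs y / ((V y : ℝ) : ℂ)) = s.indicator fun _ => (1 : ℂ) := by
    ext y
    have h0 : ((V y : ℝ) : ℂ) ≠ 0 := by exact_mod_cast (hVpos y).ne'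
    rw [weightIndicator_apply]
    by_cases hy : y ∈ s
    · rw [Set.indicator_of_mem hy, Set.indicator_of_mem hy, div_self h0]
    · rw [Set.indicator_of_notMem hy, Set.indicator_of_notMem hy, zero_div]
  rw [weightedKernelOp_apply, h, integral_indicator hs, setIntegral_const]
  simp

theorem hasDensity_weightedKernelOp_sub (hV : Measurable V) (R : Kernel E E) [IsFiniteKernel R]
    (ν : Measure E) [IsFiniteMeasure ν] {a : E → E → ℝ≥0} (ha : Measurable (Function.uncurry a))
    (B : Kernel E E) [IsFiniteKernel B]
    (h : ∀ x, R x = ν.withDensity (fun y => (a x y : ℝ≥0∞)) + B x) :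
    HasDensity (weightedKernelOp hV R - weightedKernelOp hV B) ν
      fun p => ((a p.1 p.2 : ℝ) : ℂ) := by
  intro f x
  have hax : IsFiniteMeasure (ν.withDensity fun y => (a x y : ℝ≥0∞)) :=
    isFiniteMeasure_of_le (R x) (by rw [h x]; exact Measure.le_add_right le_rfl)
  have hsub : (weightedKernelOp hV R - weightedKernelOp hV B) f x
      = weightedKernelOp hV R f x - weightedKernelOp hV B f x := by
    rw [_root_.sub_apply, sub_eq_add_neg, sub_eq_add_neg]; rfl
  rw [hsub, weightedKernelOp_apply, weightedKernelOp_apply, h x,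
    integral_add_measure (f.integrable_div hV _) (f.integrable_div hV _),
    integral_withDensity_eq_integral_smul ha.of_uncurry_left, mul_add, add_sub_cancel_right]
  simp only [NNReal.smul_def, Complex.real_smul]

/-- For a compact operator `K`, the functionals `f ↦ K f x / V x` form a totally bounded family:
up to `ε`, finitely many points `x` suffice. -/
theorem exists_finite_net_of_isCompactOperator {K : WeightedLinf V →L[ℂ] WeightedLinf V}
    (hK : IsCompactOperator K) {ε : ℝ} (hε : 0 < ε) :
    ∃ t : Finset E, ∀ x, ∃ z ∈ t, ∀ f : WeightedLinf V, ‖f‖ ≤ 1 →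
      ‖K f x / ((V x : ℝ) : ℂ) - K f z / ((V z : ℝ) : ℂ)‖ ≤ ε := by
  classical
  rcases isEmpty_or_nonempty E with hE | hE
  · exact ⟨∅, isEmptyElim⟩
  have hε3 : 0 < ε / 3 := by positivity
  have htb : TotallyBounded (K '' Metric.closedBall 0 1) :=
    (hK.isCompact_closure_image_closedBall (f := K.toLinearMap) 1).totallyBounded.subset
      subset_closure
  obtain ⟨u, -, hu, hcover⟩ := Metric.finite_approx_of_totallyBounded htb _ hε3
  have : Fintype u := hu.fintype
  -- The finitely many functions in the net map `E` to a bounded subset of `ℂ ^ u`.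
  let Φ : E → (u → ℂ) := fun x g => g.1 x / ((V x : ℝ) : ℂ)
  have hbdd : TotallyBounded (Set.range Φ) := by
    refine (Metric.isCompact_of_isClosed_isBounded isClosed_closure (Bornology.IsBounded.closure
      (isBounded_iff_forall_norm_le.2 ⟨∑ g : u, ‖g.1‖, ?_⟩))).totallyBounded.subset subset_closure
    rintro _ ⟨x, rfl⟩
    refine (pi_norm_le_iff_of_nonneg (Finset.sum_nonneg fun _ _ => norm_nonneg _)).2 fun g => ?_
    exact (g.1.norm_div_le x).trans
      (Finset.single_le_sum (f := fun g : u => ‖g.1‖) (fun _ _ => norm_nonneg _)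
        (Finset.mem_univ g))
  obtain ⟨v, hv, hvf, hvc⟩ := Metric.finite_approx_of_totallyBounded hbdd _ hε3
  choose! p hp using fun y (hy : y ∈ v) => hv hy
  refine ⟨hvf.toFinset.image p, fun x => ?_⟩
  obtain ⟨y, hy, hxy⟩ := Set.mem_iUnion₂.1 (hvc ⟨x, rfl⟩)
  refine ⟨p y, Finset.mem_image_of_mem _ (hvf.mem_toFinset.2 hy), fun f hf => ?_⟩
  obtain ⟨g, hg, hfg⟩ := Set.mem_iUnion₂.1 (hcover ⟨f, by simpa using hf, rfl⟩)
  rw [← hp y hy, Metric.mem_ball, dist_eq_norm] at hxy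
  rw [Metric.mem_ball, dist_eq_norm] at hfg
  have hclose : ∀ w, ‖K f w / ((V w : ℝ) : ℂ) - g w / ((V w : ℝ) : ℂ)‖ ≤ ε / 3 := fun w => by
    have h := ((K f - g).norm_div_le w).trans hfg.le
    have : (K f - g) w = K f w - g w := by rw [sub_eq_add_neg, sub_eq_add_neg]; rfl
    rwa [this, sub_div] at h
  have hmid : ‖g x / ((V x : ℝ) : ℂ) - g (p y) / ((V (p y) : ℝ) : ℂ)‖ ≤ ε / 3 :=
    (norm_le_pi_norm (Φ x - Φ (p y)) ⟨g, hg⟩).trans hxy.le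
  have h1 := hclose x
  have h2 := hclose (p y)
  rw [norm_sub_rev] at h2
  have := norm_add₃_le (a := K f x / ((V x : ℝ) : ℂ) - g x / ((V x : ℝ) : ℂ))
    (b := g x / ((V x : ℝ) : ℂ) - g (p y) / ((V (p y) : ℝ) : ℂ))
    (c := g (p y) / ((V (p y) : ℝ) : ℂ) - K f (p y) / ((V (p y) : ℝ) : ℂ))
  rw [sub_add_sub_cancel, sub_add_sub_cancel] at this
  linarith

/-- If a finite kernel `R` satisfies `R(x, s) ≤ K(V 1_s)(x) / V(x) + θ` with `K` positive and
compact, then for `ε > 0` a single finite measure `ν` satisfies `R(x, s) ≤ ν(s) + θ + ε`. -/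
theorem exists_measure_dominating (hV : Measurable V)
    {K : WeightedLinf V →L[ℂ] WeightedLinf V} (hKpos : IsPositiveOp K)
    (hK : IsCompactOperator K) (R : Kernel E E) {θ ε : ℝ} (hθ : 0 ≤ θ) (hε : 0 < ε)
    (hR : ∀ x s (hs : MeasurableSet s),
      R x s ≤ ENNReal.ofReal ((K (weightIndicator hV hs) x).re / V x + θ)) :
    ∃ ν : Measure E, IsFiniteMeasure ν ∧
      ∀ x s, MeasurableSet s → R x s ≤ ν s + ENNReal.ofReal (θ + ε) := by
  classical
  obtain ⟨t, ht⟩ := exists_finite_net_of_isCompactOperator hK hε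
  let q : ∀ s : Set E, MeasurableSet s → E → ℝ := fun s hs z =>
    (K (weightIndicator hV hs) z).re / V z
  have hq0 : ∀ s hs z, 0 ≤ q s hs z := fun s hs z => div_nonneg
    (Complex.le_def.1 (hKpos _ (weightIndicator_nonneg hV hs) z)).1 (V z).coe_nonneg
  let m : Set E → ℝ≥0∞ := fun s =>
    if hs : MeasurableSet s then ∑ z ∈ t, ENNReal.ofReal (q s hs z) else 0
  have hm : ∀ s (hs : MeasurableSet s), m s = ∑ z ∈ t, ENNReal.ofReal (q s hs z) :=
    fun s hs => dif_pos hs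
  have hadd : ∀ s u, MeasurableSet s → MeasurableSet u → Disjoint s u →
      m (s ∪ u) = m s + m u := by
    intro s u hs hu hsu
    rw [hm _ hs, hm _ hu, hm _ (hs.union hu), ← Finset.sum_add_distrib]
    refine Finset.sum_congr rfl fun z _ => ?_
    rw [← ENNReal.ofReal_add (hq0 _ _ _) (hq0 _ _ _)]
    simp only [q, weightIndicator_union hV hs hu hsu, map_add, WeightedLinf.add_apply,
      Complex.add_re, add_div]
  have hmfin : m Set.univ ≠ ∞ := by
    rw [hm _ .univ]
    exact (ENNReal.sum_lt_top.2 fun _ _ => ENNReal.ofReal_lt_top).ne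
  have hm0 : m ∅ = 0 := by
    have h := hadd ∅ Set.univ .empty .univ (Set.empty_disjoint _)
    rw [Set.empty_union] at h
    exact (ENNReal.add_left_inj hmfin).1 (h.symm.trans (zero_add _).symm)
  obtain ⟨ν, hν, hdom⟩ := exists_measure_of_charge m hm0 hmfin hadd
  refine ⟨ν, hν, fun x => hdom (R x) _ fun s hs => ?_⟩
  obtain ⟨z, hz, hxz⟩ := ht x
  have hle : q s hs x ≤ q s hs z + ε := by
    have h := (Complex.re_le_norm _).trans (hxz _ (norm_weightIndicator_le hV hs))
    rw [Complex.sub_re, Complex.div_ofReal_re, Complex.div_ofReal_re] at h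
    linarith
  calc R x s ≤ ENNReal.ofReal (q s hs z + (θ + ε)) :=
        (hR x s hs).trans (ENNReal.ofReal_le_ofReal (by linarith))
    _ = ENNReal.ofReal (q s hs z) + ENNReal.ofReal (θ + ε) :=
        ENNReal.ofReal_add (hq0 _ _ _) (by linarith)
    _ ≤ m s + ENNReal.ofReal (θ + ε) := by
        rw [hm s hs]
        gcongr
        exact Finset.single_le_sum (f := fun z => ENNReal.ofReal (q s hs z))
          (fun _ _ => zero_le) hz

end Reduction

theorem mainTheorem5 {E : Type*} [MeasurableSpace E] [MeasurableSpace.CountablyGenerated E]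
    (V : E → ℝ≥0) (hV : Measurable V) (hVpos : ∀ x, 0 < V x)
    (P : Kernel E E) (hP : IsWeightedKernel V P)
    (E_K : Set E) (hE_K : MeasurableSet E_K)
    (θ₁ : ℝ) (hθ₁ : 0 < θ₁) (hθ₁r : ENNReal.ofReal θ₁ < spectralRadius ℂ (kernelOp V P hP))
    (H1 : ∀ x ∉ E_K, ∫⁻ y, V y ∂(P x) ≤ ENNReal.ofReal θ₁ * V x)
    (θ₂ : ℝ) (hθ₂ : 0 < θ₂) (hθ₂r : ENNReal.ofReal θ₂ < spectralRadius ℂ (kernelOp V P hP))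
    (K : WeightedLinf V →L[ℂ] WeightedLinf V)
    (hKpos : WeightedLinf.IsPositiveOp K) (hKcomp : IsCompactOperator K)
    (H2 : ∀ x ∈ E_K, ∀ f : WeightedLinf V, f.Nonneg →
      0 ≤ kernelOp V P hP f x ∧
        kernelOp V P hP f x ≤ K f x + ((θ₂ * V x * ‖f‖ : ℝ) : ℂ)) :
    IsQuasiCompact (kernelOp V P hP) ∧
      essSpectralRadius (kernelOp V P hP) ≤ max θ₁ θ₂ := by
  have hfin := isFiniteKernel_normalizedKernel hV hVpos hP
  have hop := kernelOp_eq_weightedKernelOp hV hVpos P hP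
  set Q := normalizedKernel hV P with hQ
  have hdom : ∀ x s (hs : MeasurableSet s), Q x s ≤
      ENNReal.ofReal ((K (WeightedLinf.weightIndicator hV hs) x).re / V x + max θ₁ θ₂) := by
    intro x s hs
    have hVx : (0 : ℝ) < V x := hVpos x
    have hpos := (Complex.le_def.1
      (hKpos _ (WeightedLinf.weightIndicator_nonneg hV hs) x)).1
    rw [Complex.zero_re] at hpos
    by_cases hx : x ∈ E_K
    · have h := (Complex.le_def.1 (H2 x hx _ (WeightedLinf.weightIndicator_nonneg hV hs)).2).1
      rw [hop, weightedKernelOp_weightIndicator hV hVpos Q hs, Complex.add_re,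
        Complex.ofReal_re, Complex.ofReal_re] at h
      have hn : θ₂ * V x * ‖WeightedLinf.weightIndicator hV hs‖ ≤ θ₂ * V x :=
        mul_le_of_le_one_right (by positivity) (WeightedLinf.norm_weightIndicator_le hV hs)
      rw [← ofReal_measureReal]
      refine ENNReal.ofReal_le_ofReal (le_trans ?_ (add_le_add_right (le_max_right θ₁ θ₂) _))
      rw [← sub_le_iff_le_add, le_div_iff₀ hVx]
      linarith
    · refine (measure_mono (Set.subset_univ s)).trans
        ((normalizedKernel_univ_le hV P (hVpos x) (H1 x hx)).trans
          (ENNReal.ofReal_le_ofReal ?_))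
      have : 0 ≤ (K (WeightedLinf.weightIndicator hV hs) x).re / V x := div_nonneg hpos hVx.le
      linarith [le_max_left θ₁ θ₂]
  have hess : essSpectralRadius (kernelOp V P hP) ≤ max θ₁ θ₂ := by
    refine le_of_forall_pos_le_add fun ε hε => ?_
    have hθ : 0 < max θ₁ θ₂ := lt_max_of_lt_left hθ₁
    obtain ⟨ν, hν, hQν⟩ := exists_measure_dominating hV hKpos hKcomp Q hθ.le hε hdom
    obtain ⟨a, B, ha, ha1, hB, hsum⟩ := exists_density_add_kernel Q ν _ hQν
    have hBfin : IsFiniteKernel B := ⟨_, ENNReal.ofReal_lt_top, hB⟩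
    have hA := hasDensity_weightedKernelOp_sub hV Q ν ha B hsum
    have hwords : ∀ k, (weightedKernelOp hV Q - weightedKernelOp hV B) *
        weightedKernelOp hV B ^ k * (weightedKernelOp hV Q - weightedKernelOp hV B) ∈
          compactClosure (WeightedLinf V) := fun k =>
      hA.mul_mul_mem_compactClosure hV hVpos
        (Complex.measurable_ofReal.comp ha.coe_nnreal_real) (fun p => by
          rw [Complex.norm_real, Real.norm_of_nonneg (a p.1 p.2).coe_nonneg]
          exact_mod_cast ha1 p.1 p.2)
        ((dominatesL1_weightedKernelOp hV hVpos B).pow k)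
    have h := essSpectralRadius_add_le (by positivity)
      (norm_weightedKernelOp_le hV B (by positivity) hB) hwords
    rwa [sub_add_cancel, ← hop] at h
  refine ⟨(ENNReal.ofReal_le_ofReal hess).trans_lt ?_, hess⟩
  rcases max_choice θ₁ θ₂ with h | h <;> rw [h] <;> assumption
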